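/- **Vocabulary.** Predicates $p$ have an arity, terms are variables or constants. An existential rule $R: B\to H$ consists of two finite sets of atoms, its body $B$ and head $H$. A variable is a *frontier* variable of $R$ if it occurs in $B$ and in $H$, and *existential* if it occurs in $H$ only. Let $\mathcal R$ be a finite set of existential rules. Variables are understood relative to their rule. A *predicate position* is a pair $(p,i)$ with $1\le i\le \mathrm{arity}(p)$. The *skolemisation* of $R$ replaces each existential variable $y$ of $H$ by $f^R_y(\vec x)$, with $\vec x$ the frontier variables of $R$. **Classes of rule sets.** The *predicate position graph* has, for each rule $B\to H$ of $\mathcal R$, each frontier variable $x$ and each position $(p,i)$ of $x$ in $B$, an edge from $(p,i)$ to each position of $x$ in $H$, and a special edge from $(p,i)$ to each position of each existential variable of the rule. * *wa* (weakly acyclic): no cycle of this graph passes through a special edge. * *fd* (finite domain): all predicate positions belong to the greatest set $S$ such that, whenever $q\in S$ is filled by a term $t$ in the head of a skolemised rule, either $t$ is a constant; or $t$ is a variable occurring in the body at a position of $S$; or $t$ is a Skolem term and each of its variables occurs in the body at a position of $S$ that lies on no common cycle with $q$ in the predicate position graph (a cycle may repeat vertices). * *ar* (argument-restricted): there is a map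 $\alpha$ from predicate positions to $\mathbb N$ such that, for each rule and each frontier variable $x$ of it, every head position $q$ of $x$ has a body position $p$ of $x$ with $\alpha(p)\le\alpha(q)$, and every position $q$ of an existential variable of the rule has a body position $p$ of $x$ with $\alpha(p)<\alpha(q)$. * *ja* (jointly acyclic): for an existential variable $y$, let $\mathrm{Move}(y)$ be the smallest set of predicate positions that contains the positions of $y$ in the head of its rule and, for each rule and each frontier variable $x$ whose body positions it all contains, the head positions of $x$. There is no cycle in the graph with an edge $y\to y'$ whenever the rule of $y'$ has a frontier variable $x$ all of whose body positions are in $\mathrm{Move}(y)$. * *swa* (super-weakly acyclic): a *place* is an atom of a skolemised rule together with an index; two places unify if the indices agree and the atoms unify after renaming their variables apart; a set of places *covers* another one if each place of the latter unifies with some place of the former. For a frontier variable $x$ of $R$, $\mathrm{In}(x)$ and $\mathrm{Out}(x)$ are the places of $x$ in the body and in the skolemised head of $R$; for an existential variable $y$, $\mathrm{Out}(y)$ is the set of places of $f_y^R(\vec x)$ in the skolemised head. $\mathrm{Move}(y)$ is the smallest set of places that contains $\mathrm{Out}(y)$ and, for each frontier variable $x$ of a rule such that it covers $\mathrm{In}(x)$,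 contains $\mathrm{Out}(x)$. There is no cycle in the relation "$R$ triggers $R'$", which holds if $\mathrm{Move}(y)$ covers $\mathrm{In}(x)$ for some existential variable $y$ of $R$ and some frontier variable $x$ of $R'$. **Full position graph.** The nodes of $PG^F(\mathcal R)$ are the positions $[a,i]$ in the atoms $a$ of the bodies and heads of the rules of $\mathcal R$ (taken separately for each rule and each side), with term $t_i$ if $a=p(t_1,\dots,t_k)$. A head position is existential if its term is an existential variable of its rule. Edges: (i) within each rule, from a body position $[b,i]$ whose term is a frontier variable to a head position $[h,j]$ if both have the same term or $[h,j]$ is existential; (ii) transition edges from each position $[h,k]$ in any head to each position $[b,k]$ in any body, when $h$ and $b$ have the same predicate. **Acyclicity property.** A marking function $Y$ assigns to each node $v$ of a position graph a set $Y(v)$ of direct or indirect successors of $v$. The graph satisfies the acyclicity property of $Y$ if for no existential position $v$ is there a directed cycle through $v$ (possibly repeating nodes) all of whose nodes are in $Y(v)$. **Markings.** For a set $E$ of nodes let $\mathrm{Pr}(E)$ be the smallest set of nodes that contains the direct successors of the elements of $E$ and of the head positions that it contains and, for each rule and each frontier variable $x$ of it whose positions in the body it all contains, the non-existential direct successors of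 these positions. Say that $S$ *reaches* an existential position $e$ if the rule of $e$ has a frontier variable all of whose body positions are in $S$. * *wa-marking* of $v$: all successors of $v$. * *fd-marking* of $v$: all successors of $v$, except that $v$ itself is included only if moreover the rule of $v$ has a frontier variable all of whose body positions are successors of $v$ and direct predecessors of $v$. * *ar-marking* of $v$: the successors $w$ of $v$ such that $v,w\in E\cup\mathrm{Pr}(E)$ for some set $E$ of existential positions such that $\mathrm{Pr}(E)$ reaches each element of $E$. * *ja-marking* of $v$: write $\mathrm{Pr}[u]$ for $\mathrm{Pr}$ of the set of positions with the same term as $u$ in the same side of the same rule, and $u\leadsto w$ if $w$ is an existential position reached by $\mathrm{Pr}[u]$. The marking consists of the successors $w$ of $v$ such that, for some $u$ with $v\leadsto^* u$ (reflexive-transitive closure), $w\in\mathrm{Pr}[u]$ or $u\leadsto w$. * *swa-marking* of $v$: the ja-marking of $v$ computed in the subgraph that keeps only those transition edges $[h,k]\to[b,k]$ for which $b$ unifies, variables renamed apart, with the skolemisation of $h$. **Proposition.** A finite set $\mathcal R$ of existential rules is wa (resp. fd, ar, ja, swa) if and only if $PG^F(\mathcal R)$ satisfies the acyclicity property associated with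 the wa-marking (resp. fd-, ar-, ja-, swa-marking). -/

import Mathlib

/-! Existential rules over a function-free vocabulary with predicates `P`
(of arity `ar p`), variables `V` and constants `C`. -/

/-- Terms: variables or constants. -/
inductive Term (V C : Type*) where
  | var (x : V)
  | cst (c : C)

/-- An atom `p(t₁, …, t_k)` with `k = ar p`. -/
structure RAtom (P : Type*) (ar : P → ℕ) (V C : Type*) where
  pred : P
  args : Fin (ar pred) → Term V C

/-- The two sides of a rule. -/
inductive Side where
  | body
  | head

/-- An existential rule `B → H`, where `B` and `H` are finite atomsets. -/
structure ERule (P : Type*) (ar : P → ℕ) (V C : Type*) where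
  body : Finset (RAtom P ar V C)
  head : Finset (RAtom P ar V C)

/-- Positions `(p, i)` in predicates. -/
abbrev Pos (P : Type*) (ar : P → ℕ) := Σ p : P, Fin (ar p)

namespace ERule

variable {P : Type*} {ar : P → ℕ} {V C : Type*}

def atoms (R : ERule P ar V C) : Side → Finset (RAtom P ar V C)
  | Side.body => R.body
  | Side.head => R.head

/-- The set of predicate positions at which the variable `x` occurs in the given side of `R`. -/
def posOf (R : ERule P ar V C) (s : Side) (x : V) : Set (Pos P ar) :=
  {q | ∃ a ∈ R.atoms s, ∃ i : Fin (ar a.pred), a.args i = Term.var x ∧ q = ⟨a.pred, i⟩}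

/-- The variables that occur in the given side of `R`. -/
def vars (R : ERule P ar V C) (s : Side) : Set V :=
  {x | ∃ a ∈ R.atoms s, ∃ i : Fin (ar a.pred), a.args i = Term.var x}

/-- Frontier variables occur in both the body and the head. -/
def frontier (R : ERule P ar V C) : Set V :=
  R.vars Side.body ∩ R.vars Side.head

/-- Existential variables occur in the head only. -/
def existentials (R : ERule P ar V C) : Set V :=
  R.vars Side.head \ R.vars Side.body

end ERule

/-! ### The known acyclicity notions -/

section Classes

variable {P : Type*} {ar : P → ℕ} {V C : Type*}

/-- Ordinary edges of the predicate position graph: from a body position of a frontier variable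
to each head position of the same variable. -/
def RegularEdge (Rs : Finset (ERule P ar V C)) (p q : Pos P ar) : Prop :=
  ∃ R ∈ Rs, ∃ x ∈ R.frontier, p ∈ R.posOf Side.body x ∧ q ∈ R.posOf Side.head x

/-- Special edges: from a body position of a frontier variable to each (head) position of an
existential variable. -/
def SpecialEdge (Rs : Finset (ERule P ar V C)) (p q : Pos P ar) : Prop :=
  ∃ R ∈ Rs, ∃ x ∈ R.frontier, ∃ y ∈ R.existentials,
    p ∈ R.posOf Side.body x ∧ q ∈ R.posOf Side.head y

/-- Edges, ordinary or special, of the predicate position graph. -/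
def PredEdge (Rs : Finset (ERule P ar V C)) (p q : Pos P ar) : Prop :=
  RegularEdge Rs p q ∨ SpecialEdge Rs p q

/-- Weak acyclicity: no cycle of the predicate position graph passes through a special edge. -/
def WeaklyAcyclic (Rs : Finset (ERule P ar V C)) : Prop :=
  ¬ ∃ p q : Pos P ar, SpecialEdge Rs p q ∧ Relation.ReflTransGen (PredEdge Rs) q p

/-- `p` is recursive with `q` if some cycle passes through both. The argument graph of the
skolemised rules is the predicate position graph, because an existential variable is replaced by
a functional term over the frontier variables. -/
def RecursiveWith (Rs : Finset (ERule P ar V C)) (p q : Pos P ar) : Prop :=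
  Relation.TransGen (PredEdge Rs) p q ∧ Relation.TransGen (PredEdge Rs) q p

/-- The condition defining a set of finite-domain positions, for the skolemised rules: whenever a
position `q ∈ S` is filled, in the head of a rule, by a term `t`, then `t` is a constant, or a
variable that occurs in the body at a position of `S`, or a Skolem term such that each of its
variables occurs in the body at a position of `S` that is not recursive with `q`. -/
def IsFDSet (Rs : Finset (ERule P ar V C)) (S : Set (Pos P ar)) : Prop :=
  ∀ R ∈ Rs, ∀ h ∈ R.head, ∀ i : Fin (ar h.pred), (⟨h.pred, i⟩ : Pos P ar) ∈ S →
    (∃ c : C, h.args i = Term.cst c) ∨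
    (∃ x ∈ R.frontier, h.args i = Term.var x ∧ ∃ p ∈ R.posOf Side.body x, p ∈ S) ∨
    (∃ y ∈ R.existentials, h.args i = Term.var y ∧
      ∀ x ∈ R.frontier, ∃ p ∈ R.posOf Side.body x, p ∈ S ∧ ¬ RecursiveWith Rs p ⟨h.pred, i⟩)

/-- Finite domain: the greatest set of finite-domain positions contains every position. -/
def FiniteDomain (Rs : Finset (ERule P ar V C)) : Prop :=
  ⋃₀ {S : Set (Pos P ar) | IsFDSet Rs S} = Set.univ

/-- Argument rankings, for the skolemised rules. -/
def IsArgumentRanking (Rs : Finset (ERule P ar V C)) (α : Pos P ar → ℕ) : Prop :=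
  ∀ R ∈ Rs, ∀ x ∈ R.frontier,
    (∀ q ∈ R.posOf Side.head x, ∃ p ∈ R.posOf Side.body x, α p ≤ α q) ∧
    (∀ y ∈ R.existentials, ∀ q ∈ R.posOf Side.head y, ∃ p ∈ R.posOf Side.body x, α p < α q)

/-- Argument-restricted: there is an argument ranking. -/
def ArgumentRestricted (Rs : Finset (ERule P ar V C)) : Prop :=
  ∃ α : Pos P ar → ℕ, IsArgumentRanking Rs α

/-- `Move(y)` for an existential variable `y` of `R₀`: the smallest set of positions that contains
the positions of `y` in the head of `R₀`, and the head positions of each frontier variable all of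
whose body positions it contains. -/
def jaMove (Rs : Finset (ERule P ar V C)) (R₀ : ERule P ar V C) (y : V) : Set (Pos P ar) :=
  ⋂₀ {S | R₀.posOf Side.head y ⊆ S ∧
    ∀ R ∈ Rs, ∀ x ∈ R.frontier, R.posOf Side.body x ⊆ S → R.posOf Side.head x ⊆ S}

/-- The existential dependency graph; an existential variable is given with its rule. -/
def JADep (Rs : Finset (ERule P ar V C)) (u v : ERule P ar V C × V) : Prop :=
  u.1 ∈ Rs ∧ u.2 ∈ u.1.existentials ∧ v.1 ∈ Rs ∧ v.2 ∈ v.1.existentials ∧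
    ∃ x ∈ v.1.frontier, v.1.posOf Side.body x ⊆ jaMove Rs u.1 u.2

/-- Joint acyclicity: the existential dependency graph has no cycle. -/
def JointlyAcyclic (Rs : Finset (ERule P ar V C)) : Prop :=
  ∀ u : ERule P ar V C × V, ¬ Relation.TransGen (JADep Rs) u u

end Classes

/-! ### Skolemisation and unification -/

/-- Terms with the Skolem functions `f_y^R`, whose arguments are indexed by the frontier
variables of `R`. -/
inductive STerm (P : Type*) (ar : P → ℕ) (V C : Type*) where
  | var (x : V)
  | cst (c : C)
  | sk (R : ERule P ar V C) (y : V) (args : R.frontier → STerm P ar V C)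

namespace STerm

variable {P : Type*} {ar : P → ℕ} {V C : Type*}

/-- Application of a substitution. -/
def subst (σ : V → STerm P ar V C) : STerm P ar V C → STerm P ar V C
  | var x => σ x
  | cst c => cst c
  | sk R y args => sk R y (fun z => (args z).subst σ)

def ofTerm : Term V C → STerm P ar V C
  | Term.var x => var x
  | Term.cst c => cst c

open Classical in
/-- The term that replaces `t` in the head of the skolemisation of `R`: an existential variable `y`
becomes `f_y^R(x⃗)`, where `x⃗` are the frontier variables of `R`. -/
noncomputable def skolemize (R : ERule P ar V C) : Term V C → STerm P ar V C
  | Term.var x => if x ∈ R.vars Side.body then var x else sk R x (fun z => var z.1)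
  | Term.cst c => cst c

end STerm

/-- Atoms over terms with Skolem functions. -/
structure SAtom (P : Type*) (ar : P → ℕ) (V C : Type*) where
  pred : P
  args : Fin (ar pred) → STerm P ar V C

/-- A place `⟨a, i⟩`. -/
structure Place (P : Type*) (ar : P → ℕ) (V C : Type*) where
  atom : SAtom P ar V C
  idx : Fin (ar atom.pred)

section SWA

variable {P : Type*} {ar : P → ℕ} {V C : Type*}

def SAtom.subst (σ : V → STerm P ar V C) (a : SAtom P ar V C) : SAtom P ar V C :=
  ⟨a.pred, fun i => (a.args i).subst σ⟩

/-- The atom `a`, seen in the given side of the skolemisation of `R` (bodies are unchanged). -/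
noncomputable def ERule.skAtom (R : ERule P ar V C) (s : Side) (a : RAtom P ar V C) :
    SAtom P ar V C where
  pred := a.pred
  args i := match s with
    | Side.body => STerm.ofTerm (a.args i)
    | Side.head => STerm.skolemize R (a.args i)

/-- Two atoms unify after their variables have been renamed apart. -/
def SAtom.Unifiable (a b : SAtom P ar V C) : Prop :=
  ∃ σ τ : V → STerm P ar V C, a.subst σ = b.subst τ

/-- Two places unify: the same index, and the atoms unify. -/
def Place.Unifiable (p q : Place P ar V C) : Prop :=
  p.atom.Unifiable q.atom ∧ (p.idx : ℕ) = (q.idx : ℕ)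

/-- `In(x)` (body) and `Out(x)` (head): the places of the variable `x`, or of the Skolem term that
replaces it, in the skolemisation of `R`. -/
def ERule.places (R : ERule P ar V C) (s : Side) (x : V) : Set (Place P ar V C) :=
  {p | ∃ a ∈ R.atoms s, ∃ i : Fin (ar a.pred), a.args i = Term.var x ∧
    p = ⟨R.skAtom s a, i⟩}

/-- `S` covers `T`: every place of `T` unifies with a place of `S`. -/
def Covers (S T : Set (Place P ar V C)) : Prop :=
  ∀ q ∈ T, ∃ p ∈ S, p.Unifiable q

/-- `Move(y)` for an existential variable `y` of `R₀`: the smallest set of places that contains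
`Out(y)`, and `Out(x)` for each frontier variable `x` such that it covers `In(x)`. -/
def swaMove (Rs : Finset (ERule P ar V C)) (R₀ : ERule P ar V C) (y : V) :
    Set (Place P ar V C) :=
  ⋂₀ {S | R₀.places Side.head y ⊆ S ∧
    ∀ R ∈ Rs, ∀ x ∈ R.frontier, Covers S (R.places Side.body x) → R.places Side.head x ⊆ S}

/-- The trigger relation on rules. -/
def Triggers (Rs : Finset (ERule P ar V C)) (R R' : ERule P ar V C) : Prop :=
  R ∈ Rs ∧ R' ∈ Rs ∧ ∃ y ∈ R.existentials, ∃ x ∈ R'.frontier,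
    Covers (swaMove Rs R y) (R'.places Side.body x)

/-- Super-weak acyclicity: the trigger relation has no cycle. -/
def SuperWeaklyAcyclic (Rs : Finset (ERule P ar V C)) : Prop :=
  ∀ R : ERule P ar V C, ¬ Relation.TransGen (Triggers Rs) R R

end SWA

/-! ### Position graphs -/

/-- The positions `[a, i]` in the atoms of the rules of `Rs`. The rule and the side are recorded,
so that the position graphs of distinct rules are disjoint even if the rules share atoms. -/
structure PNode {P : Type*} {ar : P → ℕ} {V C : Type*} (Rs : Finset (ERule P ar V C)) where
  rule : ERule P ar V C
  rule_mem : rule ∈ Rs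
  side : Side
  atom : RAtom P ar V C
  atom_mem : atom ∈ rule.atoms side
  idx : Fin (ar atom.pred)

section Graphs

variable {P : Type*} {ar : P → ℕ} {V C : Type*} {Rs : Finset (ERule P ar V C)}

namespace PNode

def term (v : PNode Rs) : Term V C := v.atom.args v.idx

def pos (v : PNode Rs) : Pos P ar := ⟨v.atom.pred, v.idx⟩

/-- Existential positions. -/
def IsExistential (v : PNode Rs) : Prop :=
  v.side = Side.head ∧ ∃ y ∈ v.rule.existentials, v.term = Term.var y

/-- The positions of the variable `x` in the body of `R`. -/
def bodyOf (Rs : Finset (ERule P ar V C)) (R : ERule P ar V C) (x : V) : Set (PNode Rs) :=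
  {b | b.rule = R ∧ b.side = Side.body ∧ b.term = Term.var x}

/-- The positions with the same term as `v`, in the same side of the same rule. -/
def siblings (v : PNode Rs) : Set (PNode Rs) :=
  {u | u.rule = v.rule ∧ u.side = v.side ∧ u.term = v.term}

end PNode

/-- The basic position graph of `Rs`. -/
def basicPG (Rs : Finset (ERule P ar V C)) : Digraph (PNode Rs) where
  Adj b h := b.rule = h.rule ∧ b.side = Side.body ∧ h.side = Side.head ∧
    (∃ x ∈ b.rule.frontier, b.term = Term.var x) ∧ (b.term = h.term ∨ h.IsExistential)

/-- The full position graph `PG^F`: all transition edges, from a position in a rule head to a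
position with the same predicate and index in a rule body, are added. -/
def fullPG (Rs : Finset (ERule P ar V C)) : Digraph (PNode Rs) where
  Adj u v := (basicPG Rs).Adj u v ∨
    (u.side = Side.head ∧ v.side = Side.body ∧ u.pos = v.pos)

/-- A marking function assigns to each node of a position graph a set of direct or indirect
successors of this node. -/
structure MarkingFunction (Rs : Finset (ERule P ar V C)) where
  mark : Digraph (PNode Rs) → PNode Rs → Set (PNode Rs)
  succ_of_mem : ∀ G v w, w ∈ mark G v → Relation.TransGen G.Adj v w

/-- There is a marked cycle for `v`: a directed cycle through `v` whose nodes all belong to the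
marking of `v`. -/
def HasMarkedCycle (Y : MarkingFunction Rs) (G : Digraph (PNode Rs)) (v : PNode Rs) : Prop :=
  ∃ c : Cycle (PNode Rs), c.Chain G.Adj ∧ v ∈ c ∧ ∀ w ∈ c, w ∈ Y.mark G v

/-- The position graph `G` satisfies the acyclicity property associated with `Y`. -/
def SatisfiesMarking (G : Digraph (PNode Rs)) (Y : MarkingFunction Rs) : Prop :=
  ∀ v : PNode Rs, v.IsExistential → ¬ HasMarkedCycle Y G v

/-! ### The marking functions -/

/-- The wa-marking of `v`: all successors of `v`. -/
def waMarking (Rs : Finset (ERule P ar V C)) : MarkingFunction Rs where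
  mark G v := {w | Relation.TransGen G.Adj v w}
  succ_of_mem _ _ _ h := h

/-- The fd-marking of `v`: the successors of `v`, but `v` itself only if its rule has a frontier
variable `x` such that all positions of `x` in the body are successors of `v` and direct
predecessors of `v`. -/
def fdMarking (Rs : Finset (ERule P ar V C)) : MarkingFunction Rs where
  mark G v := {w | Relation.TransGen G.Adj v w ∧
    (w = v → ∃ x ∈ v.rule.frontier, ∀ b ∈ PNode.bodyOf Rs v.rule x,
      Relation.TransGen G.Adj v b ∧ G.Adj b v)}
  succ_of_mem _ _ _ h := h.1

/-- Propagation from a set `E` of positions: the smallest set `S` that contains the direct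
successors of the elements of `E` and of the head positions in `S` and, for each frontier variable
all of whose body positions are in `S`, the non-existential direct successors of these. -/
def propagate (G : Digraph (PNode Rs)) (E : Set (PNode Rs)) : Set (PNode Rs) :=
  ⋂₀ {S | (∀ v w, v ∈ E → G.Adj v w → w ∈ S) ∧
    (∀ v w, v ∈ S → v.side = Side.head → G.Adj v w → w ∈ S) ∧
    (∀ R ∈ Rs, ∀ x ∈ R.frontier, PNode.bodyOf Rs R x ⊆ S →
      ∀ b ∈ PNode.bodyOf Rs R x, ∀ w, G.Adj b w → ¬ w.IsExistential → w ∈ S)}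

/-- The rule of `e` has a frontier variable all of whose body positions are in `S`. -/
def Reaches (S : Set (PNode Rs)) (e : PNode Rs) : Prop :=
  ∃ x ∈ e.rule.frontier, PNode.bodyOf Rs e.rule x ⊆ S

/-- A set of existential positions is self-supporting if the propagation from it reaches each of
its elements. -/
def SelfSupporting (G : Digraph (PNode Rs)) (E : Set (PNode Rs)) : Prop :=
  ∀ e ∈ E, e.IsExistential ∧ Reaches (propagate G E) e

/-- The ar-marking of `v`: the successors `w` of `v` such that `v` and `w` both lie in
`E ∪ propagate G E` for some self-supporting set `E`. -/
def arMarking (Rs : Finset (ERule P ar V C)) : MarkingFunction Rs where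
  mark G v := {w | Relation.TransGen G.Adj v w ∧
    ∃ E : Set (PNode Rs), SelfSupporting G E ∧ v ∈ E ∪ propagate G E ∧ w ∈ E ∪ propagate G E}
  succ_of_mem _ _ _ h := h.1

/-- The propagation from all positions with the same term as `u` reaches the existential
position `w`. -/
def jaStep (G : Digraph (PNode Rs)) (u w : PNode Rs) : Prop :=
  w.IsExistential ∧ Reaches (propagate G u.siblings) w

/-- The ja-marking of `v`: the successors of `v` that are obtained by propagation from the term
of `v`, or from the term of an existential position that is reached from `v` in finitely many such
steps, together with the existential positions thus reached. -/
def jaMarking (Rs : Finset (ERule P ar V C)) : MarkingFunction Rs where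
  mark G v := {w | Relation.TransGen G.Adj v w ∧
    ∃ u, Relation.ReflTransGen (jaStep G) v u ∧ (w ∈ propagate G u.siblings ∨ jaStep G u w)}
  succ_of_mem _ _ _ h := h.1

/-- The subgraph that keeps only those edges from a head position to a body position for which the
skolemised head atom and the body atom unify. -/
def unifSubgraph (G : Digraph (PNode Rs)) : Digraph (PNode Rs) where
  Adj u v := G.Adj u v ∧ (u.side = Side.head → v.side = Side.body →
    (u.rule.skAtom Side.head u.atom).Unifiable (v.rule.skAtom Side.body v.atom))

/-- The swa-marking: the ja-marking computed in the subgraph whose transition edges unify. -/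
def swaMarking (Rs : Finset (ERule P ar V C)) : MarkingFunction Rs where
  mark G v := (jaMarking Rs).mark (unifSubgraph G) v
  succ_of_mem G v w h := by
    have hle : (unifSubgraph G).Adj ≤ G.Adj := fun _ _ h' => h'.1
    exact Relation.TransGen.mono hle v w h.1

end Graphs

/-! ### Cycles of a relation -/

section Cycles

open Relation

variable {α : Type*} {r : α → α → Prop}

/-! Transition edges of the full graph join nodes with equal predicate position, and rule edges
project onto edges of the predicate position graph. So a body node is a successor of a head node
exactly when its predicate position is reachable from that of the head node (`transGen_fullPG_iff`).
This settles wa, because a cycle enters an existential position through a special edge. It also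
settles fd, because a body position feeding `v` is recursive with `v` exactly when it is a successor
of `v` (`recursiveWith_iff`).

For ar, both sides say that only the empty set is self-supporting. A ranking excludes a nonempty one
by looking at an element of least rank; conversely, the rank of a position is the first stage at
which it drops out of a decreasing approximation of the greatest self-supporting set.

For ja and swa, the acyclicity property says that `jaStep` has no cycle on existential positions
(`satisfiesMarking_iff_of_mark_eq`). On body positions, propagation computes `jaMove` in the full
graph and what `swaMove` covers in the unifiable subgraph (`mem_propagate_fullPG_iff`,
`mem_propagate_unifSubgraph_iff`), so cycles of `jaStep` correspond to cycles of the dependency and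
trigger relations.

Several of these transfers need not preserve the base point of a cycle. They use finiteness of the
set of nodes: a nonempty set in which every element has a predecessor meets a cycle
(`exists_transGen_self`), and at each backward step the source can be chosen to fit. -/

theorem exists_isChain_of_transGen {N : Set α} {a b : α}
    (h : TransGen (fun x y => r x y ∧ y ∈ N) a b) :
    ∃ l : List α, (a :: (l ++ [b])).IsChain r ∧ ∀ w ∈ l ++ [b], w ∈ N := by
  induction h using TransGen.head_induction_on with
  | single h => exact ⟨[], by simpa using h.1, by simpa using h.2⟩
  | @head a c h _ ih =>
    obtain ⟨l, hl, hN⟩ := ih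
    refine ⟨c :: l, ?_, ?_⟩
    · simp only [List.cons_append, List.isChain_cons_cons]
      exact ⟨h.1, hl⟩
    · simp only [List.cons_append, List.mem_cons]
      rintro w (rfl | hw)
      exacts [h.2, hN w hw]

/-- Constraining only the targets of the steps is enough: on a closed walk the starting point is
also the last target. -/
theorem exists_cycle_of_transGen {N : Set α} {a : α}
    (h : TransGen (fun x y => r x y ∧ y ∈ N) a a) :
    ∃ c : Cycle α, c.Chain r ∧ a ∈ c ∧ ∀ w ∈ c, w ∈ N := by
  obtain ⟨l, hl, hN⟩ := exists_isChain_of_transGen h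
  refine ⟨((a :: l : List α) : Cycle α), ?_, ?_, fun w hw => hN w ?_⟩
  · rwa [Cycle.chain_coe_cons]
  · simp
  · simp only [Cycle.mem_coe_iff, List.mem_cons] at hw
    simpa [or_comm] using hw

/-- In a finite type, a nonempty set each of whose elements has a predecessor in the set
contains an element that lies on a cycle. -/
theorem exists_transGen_self [Finite α] {X : Set α} (hX : X.Nonempty)
    (h : ∀ a ∈ X, ∃ b ∈ X, r b a) : ∃ a ∈ X, TransGen r a a := by
  by_contra! hc
  -- Without cycles, `TransGen r` is a strict order on the finite set `X`, and a minimal element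
  -- would have no predecessor in `X`.
  let s : X → X → Prop := fun a b => TransGen r a b
  have : IsTrans X s := ⟨fun _ _ _ h₁ h₂ => TransGen.trans h₁ h₂⟩
  have : Std.Irrefl s := ⟨fun a => hc a a.2⟩
  have wf : WellFounded s := Finite.wellFounded_of_trans_of_irrefl s
  obtain ⟨a, ha⟩ := hX
  obtain ⟨m, -, hm⟩ := wf.has_min Set.univ ⟨⟨a, ha⟩, trivial⟩
  obtain ⟨b, hb, hbm⟩ := h m m.2
  exact hm ⟨b, hb⟩ trivial (TransGen.single hbm)

/-- The last vertex before the cycle closes lies on the same cycle. This supplies the hypothesis of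
`exists_transGen_self` for sets of points lying on cycles. -/
theorem exists_pred_transGen_self {a : α} (h : TransGen r a a) : ∃ b, r b a ∧ TransGen r b b := by
  obtain ⟨b, hab, hba⟩ := TransGen.tail'_iff.1 h
  exact ⟨b, hba, TransGen.head' hba hab⟩

end Cycles

/-! ### Nodes of the position graph -/

section Nodes

open Relation

variable {P : Type*} {ar : P → ℕ} {V C : Type*} {Rs : Finset (ERule P ar V C)}

instance : Finite Side :=
  Finite.of_surjective (fun b : Bool => if b then Side.body else Side.head) fun s => by
    cases s
    exacts [⟨true, rfl⟩, ⟨false, rfl⟩]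

instance : Finite (PNode Rs) :=
  Finite.of_surjective
    (fun t : Σ (R : Rs) (s : Side) (a : R.1.atoms s), Fin (ar a.1.pred) =>
      (⟨t.1.1, t.1.2, t.2.1, t.2.2.1.1, t.2.2.1.2, t.2.2.2⟩ : PNode Rs))
    fun v => ⟨⟨⟨v.rule, v.rule_mem⟩, v.side, ⟨v.atom, v.atom_mem⟩, v.idx⟩, rfl⟩

namespace PNode

theorem pos_mem_posOf {v : PNode Rs} {x : V} (h : v.term = Term.var x) :
    v.pos ∈ v.rule.posOf v.side x :=
  ⟨v.atom, v.atom_mem, v.idx, h, rfl⟩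

theorem mem_vars {v : PNode Rs} {x : V} (h : v.term = Term.var x) : x ∈ v.rule.vars v.side :=
  ⟨v.atom, v.atom_mem, v.idx, h⟩

theorem exists_of_mem_posOf {R : ERule P ar V C} (hR : R ∈ Rs) {s : Side} {x : V} {q : Pos P ar}
    (h : q ∈ R.posOf s x) :
    ∃ v : PNode Rs, v.rule = R ∧ v.side = s ∧ v.term = Term.var x ∧ v.pos = q := by
  obtain ⟨a, ha, i, hi, rfl⟩ := h
  exact ⟨⟨R, hR, s, a, ha, i⟩, rfl, rfl, hi, rfl⟩

theorem exists_of_mem_vars {R : ERule P ar V C} (hR : R ∈ Rs) {s : Side} {x : V}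
    (h : x ∈ R.vars s) : ∃ v : PNode Rs, v.rule = R ∧ v.side = s ∧ v.term = Term.var x := by
  obtain ⟨a, ha, i, hi⟩ := h
  exact ⟨⟨R, hR, s, a, ha, i⟩, rfl, rfl, hi⟩

theorem bodyOf_nonempty {R : ERule P ar V C} (hR : R ∈ Rs) {x : V} (hx : x ∈ R.frontier) :
    (bodyOf Rs R x).Nonempty :=
  exists_of_mem_vars hR hx.1

theorem not_isExistential {v : PNode Rs} {x : V} (h : v.term = Term.var x)
    (hx : x ∈ v.rule.frontier) : ¬ v.IsExistential := by
  rintro ⟨-, y, hy, hvy⟩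
  obtain rfl : x = y := Term.var.inj (h.symm.trans hvy)
  exact hy.2 hx.1

theorem exists_existential {R : ERule P ar V C} (hR : R ∈ Rs) {y : V} (hy : y ∈ R.existentials) :
    ∃ v : PNode Rs, v.rule = R ∧ v.IsExistential ∧ v.term = Term.var y := by
  obtain ⟨v, rfl, hs, ht⟩ := exists_of_mem_vars hR hy.1
  exact ⟨v, rfl, ⟨hs, y, hy, ht⟩, ht⟩

theorem siblings_eq {u v : PNode Rs} (h : u ∈ v.siblings) : u.siblings = v.siblings := by
  obtain ⟨h₁, h₂, h₃⟩ := h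
  simp only [siblings, h₁, h₂, h₃]

theorem IsExistential.of_mem_siblings {u v : PNode Rs} (hv : v.IsExistential)
    (h : u ∈ v.siblings) : u.IsExistential := by
  obtain ⟨h₁, h₂, h₃⟩ := h
  unfold IsExistential
  rw [h₁, h₂, h₃]
  exact hv

theorem bodyOf_subset_iff_posOf {R : ERule P ar V C} (hR : R ∈ Rs) {x : V} {S : Set (PNode Rs)}
    {T : Set (Pos P ar)} (h : ∀ b : PNode Rs, b.side = Side.body → (b ∈ S ↔ b.pos ∈ T)) :
    bodyOf Rs R x ⊆ S ↔ R.posOf Side.body x ⊆ T := by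
  constructor
  · intro hS q hq
    obtain ⟨b, hb, hs, ht, rfl⟩ := exists_of_mem_posOf hR hq
    exact (h b hs).1 (hS ⟨hb, hs, ht⟩)
  · rintro hT b ⟨rfl, hs, ht⟩
    exact (h b hs).2 (hT (hs ▸ pos_mem_posOf ht))

end PNode

theorem basicPG_adj_of_existential {v b : PNode Rs} (hv : v.IsExistential) {x : V}
    (hx : x ∈ v.rule.frontier) (hb : b ∈ PNode.bodyOf Rs v.rule x) : (basicPG Rs).Adj b v :=
  ⟨hb.1, hb.2.1, hv.1, ⟨x, hb.1 ▸ hx, hb.2.2⟩, Or.inr hv⟩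

theorem basicPG_adj_of_frontier {v b : PNode Rs} (hv : v.side = Side.head) {x : V}
    (hx : x ∈ v.rule.frontier) (hvx : v.term = Term.var x)
    (hb : b ∈ PNode.bodyOf Rs v.rule x) : (basicPG Rs).Adj b v :=
  ⟨hb.1, hb.2.1, hv, ⟨x, hb.1 ▸ hx, hb.2.2⟩, Or.inl (hb.2.2.trans hvx.symm)⟩

/-! ### Paths in the full position graph and in the predicate position graph -/

theorem predEdge_iff {p q : Pos P ar} :
    PredEdge Rs p q ↔ ∃ b h : PNode Rs, (basicPG Rs).Adj b h ∧ b.pos = p ∧ h.pos = q := by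
  constructor
  · rintro (⟨R, hR, x, hx, hp, hq⟩ | ⟨R, hR, x, hx, y, hy, hp, hq⟩) <;>
      obtain ⟨b, rfl, hbs, hbt, rfl⟩ := PNode.exists_of_mem_posOf hR hp <;>
      obtain ⟨h, hh, hhs, hht, rfl⟩ := PNode.exists_of_mem_posOf hR hq
    · exact ⟨b, h, ⟨hh.symm, hbs, hhs, ⟨x, hx, hbt⟩, Or.inl (hbt.trans hht.symm)⟩, rfl, rfl⟩
    · exact ⟨b, h, ⟨hh.symm, hbs, hhs, ⟨x, hx, hbt⟩, Or.inr ⟨hhs, y, hh ▸ hy, hht⟩⟩, rfl, rfl⟩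
  · rintro ⟨b, h, ⟨hr, hbs, hhs, ⟨x, hx, hbt⟩, ht | ⟨-, y, hy, hhy⟩⟩, rfl, rfl⟩
    · exact Or.inl ⟨b.rule, b.rule_mem, x, hx, hbs ▸ PNode.pos_mem_posOf hbt,
        hr ▸ hhs ▸ PNode.pos_mem_posOf (ht.symm.trans hbt)⟩
    · exact Or.inr ⟨b.rule, b.rule_mem, x, hx, y, hr ▸ hy, hbs ▸ PNode.pos_mem_posOf hbt,
        hr ▸ hhs ▸ PNode.pos_mem_posOf hhy⟩

theorem specialEdge_of_existential {v b : PNode Rs} (hv : v.IsExistential) {x : V}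
    (hx : x ∈ v.rule.frontier) (hb : b ∈ PNode.bodyOf Rs v.rule x) :
    SpecialEdge Rs b.pos v.pos := by
  obtain ⟨hs, y, hy, ht⟩ := hv
  obtain ⟨hb₁, hb₂, hb₃⟩ := hb
  exact ⟨v.rule, v.rule_mem, x, hx, y, hy, hb₁ ▸ hb₂ ▸ PNode.pos_mem_posOf hb₃,
    hs ▸ PNode.pos_mem_posOf ht⟩

/-- Each edge lifts to a rule edge, and consecutive lifts are joined by transition edges. Even the
empty path yields one transition edge, out of the head position `v`. -/
theorem transGen_fullPG_of_predEdge {p q : Pos P ar} (h : ReflTransGen (PredEdge Rs) p q)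
    {v b : PNode Rs} (hv : v.side = Side.head) (hvp : v.pos = p) (hb : b.side = Side.body)
    (hbq : b.pos = q) : TransGen (fullPG Rs).Adj v b := by
  induction h generalizing b with
  | refl => exact TransGen.single (Or.inr ⟨hv, hb, hvp.trans hbq.symm⟩)
  | tail _ h ih =>
    obtain ⟨c, w, hcw, hc, hw⟩ := predEdge_iff.1 h
    exact ((ih hcw.2.1 hc).tail (Or.inl hcw)).tail
      (Or.inr ⟨hcw.2.2.1, hb, hw.trans hbq.symm⟩)

theorem reflTransGen_predEdge_of_fullPG {v w : PNode Rs}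
    (h : ReflTransGen (fullPG Rs).Adj v w) : ReflTransGen (PredEdge Rs) v.pos w.pos := by
  induction h with
  | refl => exact ReflTransGen.refl
  | tail _ h ih =>
    rcases h with h | ⟨-, -, h⟩
    · exact ih.tail (predEdge_iff.2 ⟨_, _, h, rfl, rfl⟩)
    · exact h ▸ ih

/-- A body position is a successor of a head position in the full position graph if and only if
its predicate position can be reached in the predicate position graph. -/
theorem transGen_fullPG_iff {v b : PNode Rs} (hv : v.side = Side.head) (hb : b.side = Side.body) :
    TransGen (fullPG Rs).Adj v b ↔ ReflTransGen (PredEdge Rs) v.pos b.pos :=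
  ⟨fun h => reflTransGen_predEdge_of_fullPG h.to_reflTransGen,
    fun h => transGen_fullPG_of_predEdge h hv rfl hb rfl⟩

theorem basicPG_adj_of_head {u v : PNode Rs} (hv : v.side = Side.head)
    (h : (fullPG Rs).Adj u v) : (basicPG Rs).Adj u v := by
  rcases h with h | ⟨-, h, -⟩
  · exact h
  · rw [hv] at h
    cases h

/-! ### Marked cycles -/

theorem hasMarkedCycle_of_transGen {Y : MarkingFunction Rs} {G : Digraph (PNode Rs)}
    {v : PNode Rs} (h : TransGen (fun a b => G.Adj a b ∧ b ∈ Y.mark G v) v v) :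
    HasMarkedCycle Y G v :=
  exists_cycle_of_transGen h

theorem HasMarkedCycle.self_mem {Y : MarkingFunction Rs} {G : Digraph (PNode Rs)} {v : PNode Rs}
    (h : HasMarkedCycle Y G v) : v ∈ Y.mark G v := by
  obtain ⟨c, -, hv, hc⟩ := h
  exact hc v hv

/-- The targets of the steps of a walk that starts in `v` are successors of `v`. -/
theorem transGen_and_transGen {α : Type*} {r : α → α → Prop} {N : Set α} {v w : α}
    (h : TransGen (fun a b => r a b ∧ b ∈ N) v w) :
    TransGen (fun a b => r a b ∧ TransGen r v b ∧ b ∈ N) v w := by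
  induction h with
  | single h => exact TransGen.single ⟨h.1, TransGen.single h.1, h.2⟩
  | tail h₁ h₂ ih => exact ih.tail ⟨h₂.1, (TransGen.mono (fun _ _ h => h.1) _ _ h₁).tail h₂.1, h₂.2⟩

/-! ### Weak acyclicity -/

theorem weaklyAcyclic_iff (Rs : Finset (ERule P ar V C)) :
    WeaklyAcyclic Rs ↔ SatisfiesMarking (fullPG Rs) (waMarking Rs) := by
  constructor
  · intro hwa v hv hc
    have hvv : TransGen (fullPG Rs).Adj v v := hc.self_mem
    obtain ⟨b, hvb, hbv⟩ := TransGen.tail'_iff.1 hvv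
    obtain ⟨hr, hbs, -, ⟨x, hx, hbx⟩, -⟩ := basicPG_adj_of_head hv.1 hbv
    exact hwa ⟨b.pos, v.pos, specialEdge_of_existential hv (hr ▸ hx) ⟨hr, hbs, hbx⟩,
      reflTransGen_predEdge_of_fullPG hvb⟩
  · rintro h ⟨p, q, ⟨R, hR, x, hx, y, hy, hp, hq⟩, hqp⟩
    obtain ⟨b, hb, hbs, hbt, rfl⟩ := PNode.exists_of_mem_posOf hR hp
    obtain ⟨v, rfl, hvs, hvt, rfl⟩ := PNode.exists_of_mem_posOf hR hq
    have hv : v.IsExistential := ⟨hvs, y, hy, hvt⟩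
    have hvv : TransGen (fullPG Rs).Adj v v :=
      ((transGen_fullPG_iff hvs hbs).2 hqp).tail
        (Or.inl (basicPG_adj_of_existential hv hx ⟨hb, hbs, hbt⟩))
    refine h v hv (hasMarkedCycle_of_transGen ?_)
    -- Every target of a walk from `v` is a successor of `v`, hence marked.
    refine TransGen.mono ?_ _ _ (transGen_and_transGen (N := Set.univ)
      (TransGen.mono (fun _ _ h => ⟨h, trivial⟩) _ _ hvv))
    exact fun _ _ h => ⟨h.1, h.2.1⟩

/-! ### Finite domain -/

/-- In the alternatives for a given `q`, the set `S` occurs only positively, so they survive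
enlarging `S`. Hence the greatest set itself satisfies the condition. -/
theorem isFDSet_sUnion {𝒮 : Set (Set (Pos P ar))} (h : ∀ S ∈ 𝒮, IsFDSet Rs S) :
    IsFDSet Rs (⋃₀ 𝒮) := by
  rintro R hR a ha i ⟨S, hS, hi⟩
  rcases h S hS R hR a ha i hi with h | ⟨x, hx, ht, p, hp, hpS⟩ | ⟨y, hy, ht, h⟩
  · exact Or.inl h
  · exact Or.inr (Or.inl ⟨x, hx, ht, p, hp, S, hS, hpS⟩)
  · refine Or.inr (Or.inr ⟨y, hy, ht, fun x hx => ?_⟩)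
    obtain ⟨p, hp, hpS, hr⟩ := h x hx
    exact ⟨p, hp, ⟨S, hS, hpS⟩, hr⟩

theorem finiteDomain_iff_isFDSet_univ : FiniteDomain Rs ↔ IsFDSet Rs Set.univ := by
  constructor
  · intro h
    rw [← show ⋃₀ {S : Set (Pos P ar) | IsFDSet Rs S} = Set.univ from h]
    exact isFDSet_sUnion fun _ hS => hS
  · exact fun h => Set.eq_univ_of_univ_subset (Set.subset_sUnion_of_mem h)

/-- When every position belongs to the set, constants and frontier variables satisfy the condition
automatically; only Skolem terms constrain it. -/
theorem isFDSet_univ_iff : IsFDSet Rs Set.univ ↔ ∀ v : PNode Rs, v.IsExistential →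
    ∀ x ∈ v.rule.frontier, ∃ b ∈ PNode.bodyOf Rs v.rule x, ¬ RecursiveWith Rs b.pos v.pos := by
  constructor
  · rintro h v ⟨hs, y, hy, ht⟩ x hx
    obtain ⟨R, hR, s, a, ha, i⟩ := v
    obtain rfl : s = Side.head := hs
    change a.args i = Term.var y at ht
    rcases h R hR a ha i trivial with ⟨c, hc⟩ | ⟨z, hz, hzt, -⟩ | ⟨z, -, -, h⟩
    · rw [ht] at hc
      cases hc
    · rw [ht] at hzt
      obtain rfl := Term.var.inj hzt
      exact absurd hz.1 hy.2
    · obtain ⟨p, hp, -, hr⟩ := h x hx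
      obtain ⟨b, hb, hbs, hbt, rfl⟩ := PNode.exists_of_mem_posOf hR hp
      exact ⟨b, ⟨hb, hbs, hbt⟩, hr⟩
  · intro h R hR a ha i _
    rcases hi : a.args i with x | c
    · have hxh : x ∈ R.vars Side.head := ⟨a, ha, i, hi⟩
      by_cases hxb : x ∈ R.vars Side.body
      · obtain ⟨b, rfl, hbs, hbt⟩ := PNode.exists_of_mem_vars hR hxb
        exact Or.inr (Or.inl ⟨x, ⟨hxb, hxh⟩, rfl, b.pos, hbs ▸ PNode.pos_mem_posOf hbt, trivial⟩)
      · refine Or.inr (Or.inr ⟨x, ⟨hxh, hxb⟩, rfl, fun z hz => ?_⟩)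
        obtain ⟨b, ⟨hb, hbs, hbt⟩, hr⟩ :=
          h ⟨R, hR, Side.head, a, ha, i⟩ ⟨rfl, x, ⟨hxh, hxb⟩, hi⟩ z hz
        change b.rule = R at hb
        exact ⟨b.pos, hb ▸ hbs ▸ PNode.pos_mem_posOf hbt, trivial, hr⟩
    · exact Or.inl ⟨c, rfl⟩

theorem recursiveWith_iff {v b : PNode Rs} (hv : v.IsExistential) {x : V}
    (hx : x ∈ v.rule.frontier) (hb : b ∈ PNode.bodyOf Rs v.rule x) :
    RecursiveWith Rs b.pos v.pos ↔ TransGen (fullPG Rs).Adj v b := by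
  have hbv : PredEdge Rs b.pos v.pos := Or.inr (specialEdge_of_existential hv hx hb)
  rw [transGen_fullPG_iff hv.1 hb.2.1]
  refine ⟨fun h => h.2.to_reflTransGen, fun h => ⟨TransGen.single hbv, ?_⟩⟩
  -- If the two predicate positions coincide, the special edge is a loop and is itself the required
  -- nonempty path.
  rcases reflTransGen_iff_eq_or_transGen.1 h with h | h
  · rw [h] at hbv ⊢
    exact TransGen.single hbv
  · exact h

/-- The fd-marking restricts only `v` itself, and the demand for direct predecessors is automatic:
each body position of a frontier variable has an edge to each existential position of the rule. -/
theorem hasMarkedCycle_fd_iff {v : PNode Rs} (hv : v.IsExistential) :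
    HasMarkedCycle (fdMarking Rs) (fullPG Rs) v ↔
      ∃ x ∈ v.rule.frontier, ∀ b ∈ PNode.bodyOf Rs v.rule x, TransGen (fullPG Rs).Adj v b := by
  constructor
  · intro h
    obtain ⟨x, hx, hb⟩ := h.self_mem.2 rfl
    exact ⟨x, hx, fun b h => (hb b h).1⟩
  · rintro ⟨x, hx, hb⟩
    have hadj : ∀ b ∈ PNode.bodyOf Rs v.rule x, (fullPG Rs).Adj b v :=
      fun b h => Or.inl (basicPG_adj_of_existential hv hx h)
    obtain ⟨b, hbx⟩ := PNode.bodyOf_nonempty v.rule_mem hx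
    have hvv := (hb b hbx).tail (hadj b hbx)
    refine hasMarkedCycle_of_transGen ?_
    refine TransGen.mono ?_ _ _ (transGen_and_transGen (N := Set.univ)
      (TransGen.mono (fun _ _ h => ⟨h, trivial⟩) _ _ hvv))
    exact fun _ _ h => ⟨h.1, h.2.1, fun _ => ⟨x, hx, fun b h => ⟨hb b h, hadj b h⟩⟩⟩

theorem finiteDomain_iff (Rs : Finset (ERule P ar V C)) :
    FiniteDomain Rs ↔ SatisfiesMarking (fullPG Rs) (fdMarking Rs) := by
  rw [finiteDomain_iff_isFDSet_univ, isFDSet_univ_iff]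
  refine forall₂_congr fun v hv => ?_
  rw [hasMarkedCycle_fd_iff hv]
  push Not
  refine forall₂_congr fun x hx => exists_congr fun b => and_congr_right fun hb => ?_
  rw [recursiveWith_iff hv hx hb]

/-! ### Propagation -/

/-- The graphs that arise from the basic position graph by adding edges from head positions to
body positions. -/
structure IsPositionGraph (G : Digraph (PNode Rs)) : Prop where
  of_basic : ∀ u v, (basicPG Rs).Adj u v → G.Adj u v
  basic_or : ∀ u v, G.Adj u v → (basicPG Rs).Adj u v ∨ u.side = Side.head ∧ v.side = Side.body

theorem isPositionGraph_fullPG : IsPositionGraph (fullPG Rs) where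
  of_basic _ _ h := Or.inl h
  basic_or _ _ h := h.imp_right fun h => ⟨h.1, h.2.1⟩

theorem isPositionGraph_unifSubgraph : IsPositionGraph (unifSubgraph (fullPG Rs)) where
  of_basic u v h := ⟨Or.inl h, fun hu => by rw [h.2.1] at hu; cases hu⟩
  basic_or _ _ h := isPositionGraph_fullPG.basic_or _ _ h.1

theorem IsPositionGraph.side_eq_body {G : Digraph (PNode Rs)} (hG : IsPositionGraph G)
    {v w : PNode Rs} (h : G.Adj v w) (hv : v.side = Side.head) : w.side = Side.body := by
  rcases hG.basic_or _ _ h with h | h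
  · rw [h.2.1] at hv
    cases hv
  · exact h.2

section Propagate

variable {G : Digraph (PNode Rs)} {E F : Set (PNode Rs)}

theorem mem_propagate_of_adj {v w : PNode Rs} (hv : v ∈ E) (h : G.Adj v w) : w ∈ propagate G E :=
  Set.mem_sInter.2 fun _ hS => hS.1 v w hv h

theorem mem_propagate_of_head {v w : PNode Rs} (hv : v ∈ propagate G E) (hs : v.side = Side.head)
    (h : G.Adj v w) : w ∈ propagate G E :=
  Set.mem_sInter.2 fun S hS => hS.2.1 v w (Set.mem_sInter.1 hv S hS) hs h

theorem mem_propagate_of_frontier (hG : IsPositionGraph G) {v : PNode Rs}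
    (hs : v.side = Side.head) {x : V} (hx : x ∈ v.rule.frontier) (hv : v.term = Term.var x)
    (h : PNode.bodyOf Rs v.rule x ⊆ propagate G E) : v ∈ propagate G E := by
  refine Set.mem_sInter.2 fun S hS => ?_
  obtain ⟨b, hb⟩ := PNode.bodyOf_nonempty v.rule_mem hx
  exact hS.2.2 v.rule v.rule_mem x hx (h.trans (Set.sInter_subset_of_mem hS)) b hb v
    (hG.of_basic _ _ (basicPG_adj_of_frontier hs hx hv hb)) (PNode.not_isExistential hv hx)

/-- Induction principle for propagation from head positions. Edges leaving the head go to bodies,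
and the non-existential successors of the body positions of `x` are head positions of `x`, so two
cases suffice. -/
theorem propagate_subset (hG : IsPositionGraph G) (hE : ∀ v ∈ E, v.side = Side.head)
    {S : Set (PNode Rs)}
    (h₁ : ∀ v w, v ∈ E ∨ v ∈ S → v.side = Side.head → w.side = Side.body → G.Adj v w → w ∈ S)
    (h₂ : ∀ v : PNode Rs, v.side = Side.head → ∀ x ∈ v.rule.frontier, v.term = Term.var x →
      PNode.bodyOf Rs v.rule x ⊆ S → v ∈ S) :
    propagate G E ⊆ S := by
  refine Set.sInter_subset_of_mem ⟨?_, ?_, ?_⟩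
  · exact fun v w hv h => h₁ v w (Or.inl hv) (hE v hv) (hG.side_eq_body h (hE v hv)) h
  · exact fun v w hv hs h => h₁ v w (Or.inr hv) hs (hG.side_eq_body h hs) h
  · rintro R hR x hx hS b hb w h hw
    obtain ⟨hb₁, hb₂, hb₃⟩ := hb
    rcases hG.basic_or _ _ h with ⟨hr, -, hs, -, ht⟩ | h
    · obtain rfl : w.rule = R := hr.symm.trans hb₁
      exact h₂ w hs x hx ((ht.resolve_right hw).symm.trans hb₃) hS
    · rw [hb₂] at h
      cases h.1

theorem propagate_mono (h : E ⊆ F) : propagate G E ⊆ propagate G F :=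
  Set.sInter_subset_sInter fun _ hS => ⟨fun v w hv => hS.1 v w (h hv), hS.2⟩

theorem not_isExistential_of_mem_propagate (hG : IsPositionGraph G)
    (hE : ∀ v ∈ E, v.side = Side.head) {w : PNode Rs} (hw : w ∈ propagate G E) :
    ¬ w.IsExistential := by
  refine propagate_subset (S := {w | ¬ w.IsExistential}) hG hE ?_ ?_ hw
  · intro v w _ _ hs _ he
    have := he.1
    rw [hs] at this
    cases this
  · exact fun v _ x hx hv _ => PNode.not_isExistential hv hx

theorem propagate_empty (hG : IsPositionGraph G) : propagate G (∅ : Set (PNode Rs)) = ∅ := by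
  refine Set.subset_empty_iff.1 (propagate_subset hG (by simp) (by simp) ?_)
  intro v _ x hx _ h
  obtain ⟨b, hb⟩ := PNode.bodyOf_nonempty v.rule_mem hx
  exact absurd (h hb) (Set.notMem_empty b)

/-- Every position obtained by propagation from `E` is the end of a path from `E` through such
positions. -/
theorem exists_path_of_mem_propagate (hG : IsPositionGraph G) (hE : ∀ v ∈ E, v.side = Side.head)
    {w : PNode Rs} (hw : w ∈ propagate G E) :
    ∃ e ∈ E, TransGen (fun a b => G.Adj a b ∧ b ∈ propagate G E) e w := by
  -- Membership in the propagation is carried along because the frontier case needs it for all body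
  -- positions of `x`, while the path uses just one of them.
  refine (propagate_subset (S := {w | w ∈ propagate G E ∧
    ∃ e ∈ E, TransGen (fun a b => G.Adj a b ∧ b ∈ propagate G E) e w}) hG hE ?_ ?_ hw).2
  · rintro v w (hv | ⟨hv, e, he, hev⟩) hs - h
    · have hw := mem_propagate_of_adj hv h
      exact ⟨hw, v, hv, TransGen.single ⟨h, hw⟩⟩
    · have hw := mem_propagate_of_head hv hs h
      exact ⟨hw, e, he, hev.tail ⟨h, hw⟩⟩
  · intro v hs x hx hv h
    have hvp := mem_propagate_of_frontier hG hs hx hv fun b hb => (h hb).1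
    obtain ⟨b, hb⟩ := PNode.bodyOf_nonempty v.rule_mem hx
    obtain ⟨-, e, he, heb⟩ := h hb
    exact ⟨hvp, e, he, heb.tail ⟨hG.of_basic _ _ (basicPG_adj_of_frontier hs hx hv hb), hvp⟩⟩

theorem Reaches.mono {S T : Set (PNode Rs)} (h : S ⊆ T) {e : PNode Rs} (he : Reaches S e) :
    Reaches T e := by
  obtain ⟨x, hx, hb⟩ := he
  exact ⟨x, hx, hb.trans h⟩

/-- A reached existential position is the end of a path from `E` through positions obtained by
propagation. -/
theorem exists_path_of_reaches (hG : IsPositionGraph G) (hE : ∀ v ∈ E, v.side = Side.head)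
    {w : PNode Rs} (hw : w.IsExistential) (h : Reaches (propagate G E) w) :
    ∃ e ∈ E, TransGen (fun a b => G.Adj a b ∧ (b ∈ propagate G E ∨ b = w)) e w := by
  obtain ⟨x, hx, hb⟩ := h
  obtain ⟨b, hbx⟩ := PNode.bodyOf_nonempty w.rule_mem hx
  obtain ⟨e, he, heb⟩ := exists_path_of_mem_propagate hG hE (hb hbx)
  exact ⟨e, he, (TransGen.mono (fun _ _ h => ⟨h.1, Or.inl h.2⟩) _ _ heb).tail
    ⟨hG.of_basic _ _ (basicPG_adj_of_existential hw hx hbx), Or.inr rfl⟩⟩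

end Propagate

/-! ### Argument-restrictedness -/

theorem SelfSupporting.side_eq_head {G : Digraph (PNode Rs)} {E : Set (PNode Rs)}
    (hE : SelfSupporting G E) : ∀ v ∈ E, v.side = Side.head :=
  fun v hv => (hE v hv).1.1

/-- Every propagated position has rank at least that of some element of `E`. An element of `E` of
least rank is reached through a variable having a body position of smaller rank, which is
propagated, a contradiction. -/
theorem IsArgumentRanking.selfSupporting_eq_empty {α : Pos P ar → ℕ}
    (hα : IsArgumentRanking Rs α) {E : Set (PNode Rs)} (hE : SelfSupporting (fullPG Rs) E) :
    E = ∅ := by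
  by_contra hne
  have hle : propagate (fullPG Rs) E ⊆ {w | ∃ e ∈ E, α e.pos ≤ α w.pos} := by
    refine propagate_subset isPositionGraph_fullPG hE.side_eq_head ?_ ?_
    · intro v w hv hs hw hvw
      have hp : v.pos = w.pos := by
        rcases hvw with h | h
        · rw [h.2.1] at hs
          cases hs
        · exact h.2.2
      rcases hv with hv | ⟨e, he, hev⟩
      · exact ⟨v, hv, hp ▸ le_rfl⟩
      · exact ⟨e, he, hp ▸ hev⟩
    · intro v hs x hx hv h
      obtain ⟨p, hp, hpv⟩ := (hα v.rule v.rule_mem x hx).1 v.pos (hs ▸ PNode.pos_mem_posOf hv)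
      obtain ⟨b, hb, hbs, hbt, rfl⟩ := PNode.exists_of_mem_posOf v.rule_mem hp
      obtain ⟨e, he, heb⟩ := h ⟨hb, hbs, hbt⟩
      exact ⟨e, he, heb.trans hpv⟩
  obtain ⟨m, hm, hmin⟩ := (InvImage.wf (fun v : PNode Rs => α v.pos) wellFounded_lt).has_min E
    (Set.nonempty_iff_ne_empty.2 hne)
  obtain ⟨⟨hs, y, hy, hmy⟩, x, hx, hb⟩ := hE m hm
  obtain ⟨p, hp, hpm⟩ :=
    (hα m.rule m.rule_mem x hx).2 y hy m.pos (hs ▸ PNode.pos_mem_posOf hmy)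
  obtain ⟨b, hb₁, hbs, hbt, rfl⟩ := PNode.exists_of_mem_posOf m.rule_mem hp
  obtain ⟨e, he, heb⟩ := hle (hb ⟨hb₁, hbs, hbt⟩)
  exact hmin e he (heb.trans_lt hpm)

/-- Approximations from above of the greatest self-supporting set. -/
def supportStage (G : Digraph (PNode Rs)) : ℕ → Set (PNode Rs)
  | 0 => {e | e.IsExistential}
  | n + 1 => {e | e.IsExistential ∧ Reaches (propagate G (supportStage G n)) e}

theorem supportStage_succ_subset (G : Digraph (PNode Rs)) (n : ℕ) :
    supportStage G (n + 1) ⊆ supportStage G n := by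
  induction n with
  | zero => exact fun e h => h.1
  | succ n ih => exact fun e h => ⟨h.1, h.2.mono (propagate_mono ih)⟩

theorem exists_selfSupporting_supportStage (G : Digraph (PNode Rs)) :
    ∃ n, SelfSupporting G (supportStage G n) := by
  obtain ⟨_, ⟨n, rfl⟩, hn⟩ := (wellFounded_lt (α := Set (PNode Rs))).has_min
    (Set.range (supportStage G)) ⟨_, 0, rfl⟩
  -- The stages decrease, so a minimal one equals its successor; being a fixed point is
  -- self-support.
  have h : supportStage G (n + 1) = supportStage G n :=
    (supportStage_succ_subset G n).eq_of_not_lt (hn _ ⟨n + 1, rfl⟩)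
  refine ⟨n, fun e he => ?_⟩
  rw [← h] at he
  exact he

/-- The predicate positions of the head positions in the propagation from the `n`-th stage. -/
def stagePos (Rs : Finset (ERule P ar V C)) (n : ℕ) : Set (Pos P ar) :=
  {q | ∃ v : PNode Rs, v.side = Side.head ∧ v.pos = q ∧
    (v ∈ supportStage (fullPG Rs) n ∨ v ∈ propagate (fullPG Rs) (supportStage (fullPG Rs) n))}

theorem bodyOf_subset_of_posOf_subset_stagePos {R : ERule P ar V C} (hR : R ∈ Rs) {x : V} {n : ℕ}
    (h : R.posOf Side.body x ⊆ stagePos Rs n) :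
    PNode.bodyOf Rs R x ⊆ propagate (fullPG Rs) (supportStage (fullPG Rs) n) := by
  rintro b ⟨rfl, hs, ht⟩
  obtain ⟨v, hvs, hvb, hv⟩ := h (hs ▸ PNode.pos_mem_posOf ht)
  have hadj : (fullPG Rs).Adj v b := Or.inr ⟨hvs, hs, hvb⟩
  rcases hv with hv | hv
  exacts [mem_propagate_of_adj hv hadj, mem_propagate_of_head hv hvs hadj]

/-- The rank of `q` is the least `k` with `q ∉ stagePos Rs k`. It exists because some stage is
self-supporting, hence empty. -/
theorem argumentRestricted_of_forall_selfSupporting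
    (h : ∀ E : Set (PNode Rs), SelfSupporting (fullPG Rs) E → E = ∅) : ArgumentRestricted Rs := by
  classical
  obtain ⟨n, hn⟩ := exists_selfSupporting_supportStage (fullPG Rs)
  have hex : ∀ q : Pos P ar, ∃ k, q ∉ stagePos Rs k := by
    refine fun q => ⟨n, ?_⟩
    rintro ⟨v, -, -, hv⟩
    rw [h _ hn, propagate_empty isPositionGraph_fullPG] at hv
    simp at hv
  refine ⟨fun q => Nat.find (hex q), fun R hR x hx => ⟨fun q hq => ?_, fun y hy q hq => ?_⟩⟩
  -- If all body positions of `x` had larger rank than `q`, they would all be present at the stage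
  -- where `q` is missing, and would propagate to `q`.
  · by_contra! hlt
    obtain ⟨v, rfl, hvs, hvt, rfl⟩ := PNode.exists_of_mem_posOf hR hq
    refine Nat.find_spec (hex v.pos) ⟨v, hvs, rfl, Or.inr ?_⟩
    refine mem_propagate_of_frontier isPositionGraph_fullPG hvs hx hvt
      (bodyOf_subset_of_posOf_subset_stagePos hR fun p hp => ?_)
    exact not_not.1 (Nat.find_min (hex p) (hlt p hp))
  · by_contra! hle
    obtain ⟨v, rfl, hvs, hvt, rfl⟩ := PNode.exists_of_mem_posOf hR hq
    have hv : v.IsExistential := ⟨hvs, y, hy, hvt⟩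
    refine Nat.find_spec (hex v.pos) ⟨v, hvs, rfl, Or.inl ?_⟩
    -- Stage `0` contains all existential positions. At rank `m + 1` the body positions are still
    -- present at stage `m`, which puts `v` in stage `m + 1`; this shift by one gives the strict
    -- inequality.
    rcases hm : Nat.find (hex v.pos) with _ | m
    · exact hv
    · refine ⟨hv, x, hx, bodyOf_subset_of_posOf_subset_stagePos hR fun p hp => ?_⟩
      exact not_not.1 (Nat.find_min (hex p) (lt_of_lt_of_le (by omega) (hle p hp)))

theorem exists_hasMarkedCycle_of_selfSupporting {G : Digraph (PNode Rs)} (hG : IsPositionGraph G)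
    {E : Set (PNode Rs)} (hE : SelfSupporting G E) (hne : E.Nonempty) :
    ∃ v, v.IsExistential ∧ HasMarkedCycle (arMarking Rs) G v := by
  obtain ⟨v, hv, hvv⟩ := exists_transGen_self
    -- Each element of `E` is reached by a path from another element of `E`, or from itself, inside
    -- `E ∪ propagate G E`.
    (r := TransGen fun a b => G.Adj a b ∧ b ∈ E ∪ propagate G E) hne fun w hw => by
      obtain ⟨e, he, hew⟩ := exists_path_of_reaches hG hE.side_eq_head (hE w hw).1 (hE w hw).2
      refine ⟨e, he, TransGen.mono ?_ _ _ hew⟩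
      rintro a b ⟨hab, hb | rfl⟩
      exacts [⟨hab, Or.inr hb⟩, ⟨hab, Or.inl hw⟩]
  rw [transGen_eq_self] at hvv
  refine ⟨v, (hE v hv).1, hasMarkedCycle_of_transGen ?_⟩
  refine TransGen.mono ?_ _ _ (transGen_and_transGen hvv)
  exact fun a b h => ⟨h.1, h.2.1, E, hE, Or.inl hv, h.2.2⟩

theorem argumentRestricted_iff (Rs : Finset (ERule P ar V C)) :
    ArgumentRestricted Rs ↔ SatisfiesMarking (fullPG Rs) (arMarking Rs) := by
  constructor
  · rintro ⟨α, hα⟩ v - hc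
    obtain ⟨-, E, hE, hv, -⟩ := hc.self_mem
    rw [hα.selfSupporting_eq_empty hE, propagate_empty isPositionGraph_fullPG] at hv
    simp at hv
  · refine fun h => argumentRestricted_of_forall_selfSupporting fun E hE => ?_
    by_contra hne
    obtain ⟨v, hv, hc⟩ := exists_hasMarkedCycle_of_selfSupporting isPositionGraph_fullPG hE
      (Set.nonempty_iff_ne_empty.2 hne)
    exact h v hv hc

/-! ### The ja-marking -/

section JaStep

variable {G : Digraph (PNode Rs)}

theorem PNode.IsExistential.siblings_side {v : PNode Rs} (hv : v.IsExistential) :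
    ∀ u ∈ v.siblings, u.side = Side.head :=
  fun _ hu => hu.2.1.trans hv.1

theorem jaStep_congr_left {u u' w : PNode Rs} (h : u' ∈ u.siblings) (hw : jaStep G u w) :
    jaStep G u' w :=
  ⟨hw.1, (PNode.siblings_eq h).symm ▸ hw.2⟩

theorem jaStep_congr_right {u w w' : PNode Rs} (h : w' ∈ w.siblings) (hw : jaStep G u w) :
    jaStep G u w' := by
  obtain ⟨he, x, hx, hb⟩ := hw
  exact ⟨he.of_mem_siblings h, x, h.1 ▸ hx, h.1 ▸ hb⟩

theorem transGen_jaStep_congr {u u' : PNode Rs} (h : u' ∈ u.siblings)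
    (hu : TransGen (jaStep G) u u) : TransGen (jaStep G) u' u' := by
  obtain ⟨w, huw, hwu⟩ := TransGen.tail'_iff.1 hu
  rcases huw.cases_head with rfl | ⟨z, huz, hzw⟩
  · exact TransGen.single (jaStep_congr_right h (jaStep_congr_left h hwu))
  · exact TransGen.head (jaStep_congr_left h huz)
      (TransGen.tail' hzw (jaStep_congr_right h hwu))

theorem isExistential_of_reflTransGen_jaStep {v u : PNode Rs} (hv : v.IsExistential)
    (h : ReflTransGen (jaStep G) v u) : u.IsExistential := by
  rcases h.cases_tail with rfl | ⟨w, -, hw⟩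
  exacts [hv, hw.1]

/-- Propagation never enters an existential position, so `v` can be marked by itself only as a
reached position. -/
theorem transGen_jaStep_of_mem_jaMarking (hG : IsPositionGraph G) {v : PNode Rs}
    (hv : v.IsExistential) (h : v ∈ (jaMarking Rs).mark G v) : TransGen (jaStep G) v v := by
  obtain ⟨-, u, hvu, hu | hu⟩ := h
  · exact absurd hv (not_isExistential_of_mem_propagate hG
      (isExistential_of_reflTransGen_jaStep hv hvu).siblings_side hu)
  · exact TransGen.tail' hvu hu

/-- A step from `u` propagates from all siblings of `u`, so the underlying path may start at a
sibling instead of `u`. Hence a `jaStep` cycle need not yield a closed walk at `v`. Going backwards,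
the source of each step is replaced by the sibling where the path starts, and finiteness closes the
walk at some `w`. -/
theorem exists_transGen_jaMarking (hG : IsPositionGraph G) {v : PNode Rs}
    (hv : v.IsExistential) (h : TransGen (jaStep G) v v) :
    ∃ w, w.IsExistential ∧
      TransGen (fun a b => G.Adj a b ∧ b ∈ (jaMarking Rs).mark G w) w w := by
  -- `Q` keeps only the steps realised by a path that starts at `e` itself, so that such paths can
  -- be concatenated.
  let Q : PNode Rs → PNode Rs → Prop := fun e e' => jaStep G e e' ∧
    TransGen (fun a b => G.Adj a b ∧ (b ∈ propagate G e.siblings ∨ b = e')) e e'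
  obtain ⟨w, ⟨hw, -⟩, hww⟩ : ∃ w ∈ {e : PNode Rs | e.IsExistential ∧ TransGen (jaStep G) e e},
      TransGen Q w w := by
    refine exists_transGen_self ⟨v, hv, h⟩ ?_
    rintro e ⟨he, hee⟩
    obtain ⟨u, hue, huu⟩ := exists_pred_transGen_self hee
    have hu : u.IsExistential := by
      obtain ⟨z, -, hz⟩ := TransGen.tail'_iff.1 huu
      exact hz.1
    obtain ⟨u', hu', hpath⟩ := exists_path_of_reaches hG hu.siblings_side he hue.2
    refine ⟨u', ⟨hu.of_mem_siblings hu', transGen_jaStep_congr hu' huu⟩,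
      jaStep_congr_left hu' hue, ?_⟩
    rwa [PNode.siblings_eq hu']
  have hQ : ∀ a b, Q a b → ReflTransGen (jaStep G) w a →
      TransGen (fun c d => G.Adj c d ∧ d ∈ {d | ∃ u, ReflTransGen (jaStep G) w u ∧
        (d ∈ propagate G u.siblings ∨ jaStep G u d)}) a b := by
    rintro a b ⟨hab, hp⟩ hwa
    refine TransGen.mono ?_ _ _ hp
    rintro c d ⟨hcd, hd | rfl⟩
    exacts [⟨hcd, a, hwa, Or.inl hd⟩, ⟨hcd, a, hwa, Or.inr hab⟩]
  refine ⟨w, hw, transGen_and_transGen (N := {d | ∃ u, ReflTransGen (jaStep G) w u ∧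
        (d ∈ propagate G u.siblings ∨ jaStep G u d)}) ?_⟩
  have key : ∀ b, TransGen Q w b → TransGen (fun c d => G.Adj c d ∧
      d ∈ {d | ∃ u, ReflTransGen (jaStep G) w u ∧
        (d ∈ propagate G u.siblings ∨ jaStep G u d)}) w b := by
    intro b hb
    induction hb with
    | single h => exact hQ _ _ h ReflTransGen.refl
    | tail h₁ h₂ ih =>
      exact ih.trans (hQ _ _ h₂ (TransGen.mono (fun _ _ h => h.1) _ _ h₁).to_reflTransGen)
  exact key w hww

/-- The acyclicity property of a marking that agrees with the ja-marking of a subgraph. -/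
theorem satisfiesMarking_iff_of_mark_eq {H : Digraph (PNode Rs)} {Y : MarkingFunction Rs}
    (hG : IsPositionGraph G) (hle : ∀ u v, G.Adj u v → H.Adj u v)
    (hY : ∀ v, Y.mark H v = (jaMarking Rs).mark G v) :
    SatisfiesMarking H Y ↔ ∀ v : PNode Rs, v.IsExistential → ¬ TransGen (jaStep G) v v := by
  constructor
  · intro h v hv hvv
    obtain ⟨w, hw, hww⟩ := exists_transGen_jaMarking hG hv hvv
    refine h w hw (hasMarkedCycle_of_transGen (TransGen.mono ?_ _ _ hww))
    exact fun a b hab => ⟨hle _ _ hab.1, (hY w).symm ▸ hab.2⟩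
  · intro h v hv hc
    exact h v hv (transGen_jaStep_of_mem_jaMarking hG hv (hY v ▸ hc.self_mem))

end JaStep

/-! ### Joint acyclicity -/

section JA

theorem posOf_subset_jaMove (R : ERule P ar V C) (y : V) :
    R.posOf Side.head y ⊆ jaMove Rs R y :=
  Set.subset_sInter fun _ hS => hS.1

theorem jaMove_closed {R₀ R : ERule P ar V C} {y : V} (hR : R ∈ Rs) {x : V} (hx : x ∈ R.frontier)
    (h : R.posOf Side.body x ⊆ jaMove Rs R₀ y) : R.posOf Side.head x ⊆ jaMove Rs R₀ y :=
  Set.subset_sInter fun _ hS => hS.2 R hR x hx (h.trans (Set.sInter_subset_of_mem hS))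

theorem pos_mem_jaMove {v w : PNode Rs} (hv : v.IsExistential) {y : V}
    (hy : v.term = Term.var y) (hw : w ∈ propagate (fullPG Rs) v.siblings) :
    w.pos ∈ jaMove Rs v.rule y := by
  refine propagate_subset (S := {w | w.pos ∈ jaMove Rs v.rule y}) isPositionGraph_fullPG
    hv.siblings_side ?_ ?_ hw
  · intro u w hu hs _ huw
    have hp : u.pos = w.pos := by
      rcases huw with h | h
      · rw [h.2.1] at hs
        cases hs
      · exact h.2.2
    change w.pos ∈ jaMove Rs v.rule y
    rw [← hp]
    rcases hu with hu | hu
    · exact posOf_subset_jaMove _ _ (hu.1 ▸ hs ▸ PNode.pos_mem_posOf (hu.2.2.trans hy))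
    · exact hu
  · intro u hs x hx hu h
    refine jaMove_closed u.rule_mem hx ?_ (hs ▸ PNode.pos_mem_posOf hu)
    intro p hp
    obtain ⟨b, hb, hbs, hbt, rfl⟩ := PNode.exists_of_mem_posOf u.rule_mem hp
    exact h ⟨hb, hbs, hbt⟩

theorem mem_propagate_fullPG_iff {v b : PNode Rs} (hv : v.IsExistential) {y : V}
    (hy : v.term = Term.var y) (hb : b.side = Side.body) :
    b ∈ propagate (fullPG Rs) v.siblings ↔ b.pos ∈ jaMove Rs v.rule y := by
  refine ⟨pos_mem_jaMove hv hy, fun h => ?_⟩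
  -- Head nodes alone generate `jaMove`; a transition edge then carries membership to every body
  -- node with the same predicate position.
  let S : Set (Pos P ar) := {q | ∃ u : PNode Rs, u.side = Side.head ∧ u.pos = q ∧
    (u ∈ v.siblings ∨ u ∈ propagate (fullPG Rs) v.siblings)}
  have hS : ∀ b : PNode Rs, b.side = Side.body → b.pos ∈ S →
      b ∈ propagate (fullPG Rs) v.siblings := by
    rintro b hb ⟨u, hs, hub, hu⟩
    have hadj : (fullPG Rs).Adj u b := Or.inr ⟨hs, hb, hub⟩
    rcases hu with hu | hu
    exacts [mem_propagate_of_adj hu hadj, mem_propagate_of_head hu hs hadj]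
  refine hS b hb (Set.mem_sInter.1 h S ⟨?_, ?_⟩)
  · intro q hq
    obtain ⟨u, hu, hs, ht, rfl⟩ := PNode.exists_of_mem_posOf v.rule_mem hq
    exact ⟨u, hs, rfl, Or.inl ⟨hu, hs.trans hv.1.symm, ht.trans hy.symm⟩⟩
  · intro R hR x hx hbody q hq
    obtain ⟨u, rfl, hs, ht, rfl⟩ := PNode.exists_of_mem_posOf hR hq
    refine ⟨u, hs, rfl, Or.inr (mem_propagate_of_frontier isPositionGraph_fullPG hs hx ht ?_)⟩
    rintro c ⟨hc, hcs, hct⟩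
    exact hS c hcs (hbody (hc ▸ hcs ▸ PNode.pos_mem_posOf hct))

theorem jaStep_fullPG_iff {v w : PNode Rs} {y z : V} (hv : v.IsExistential)
    (hvy : v.term = Term.var y) (hw : w.IsExistential) (hwz : w.term = Term.var z) :
    jaStep (fullPG Rs) v w ↔ JADep Rs (v.rule, y) (w.rule, z) := by
  have hmem : ∀ {u : PNode Rs} {t : V}, u.IsExistential → u.term = Term.var t →
      t ∈ u.rule.existentials := by
    rintro u t ⟨-, t', ht', h⟩ ht
    obtain rfl := Term.var.inj (ht.symm.trans h)
    exact ht'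
  have hiff : ∀ x, PNode.bodyOf Rs w.rule x ⊆ propagate (fullPG Rs) v.siblings ↔
      w.rule.posOf Side.body x ⊆ jaMove Rs v.rule y :=
    fun x => PNode.bodyOf_subset_iff_posOf w.rule_mem
      fun b hb => mem_propagate_fullPG_iff hv hvy hb
  constructor
  · rintro ⟨-, x, hx, hb⟩
    exact ⟨v.rule_mem, hmem hv hvy, w.rule_mem, hmem hw hwz, x, hx, (hiff x).1 hb⟩
  · rintro ⟨-, -, -, -, x, hx, hb⟩
    exact ⟨hw, x, hx, (hiff x).2 hb⟩

theorem transGen_JADep_of_jaStep {v w : PNode Rs} {y z : V} (hv : v.IsExistential)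
    (hvy : v.term = Term.var y) (hwz : w.term = Term.var z)
    (h : TransGen (jaStep (fullPG Rs)) v w) : TransGen (JADep Rs) (v.rule, y) (w.rule, z) := by
  induction h generalizing z with
  | single h => exact TransGen.single ((jaStep_fullPG_iff hv hvy h.1 hwz).1 h)
  | tail h₁ h₂ ih =>
    obtain ⟨u, -, hu⟩ := TransGen.tail'_iff.1 h₁
    obtain ⟨-, t, -, ht⟩ := hu.1
    exact (ih ht).tail ((jaStep_fullPG_iff hu.1 ht h₂.1 hwz).1 h₂)

/-- A variable may have several head positions, but any of them can serve as source of a `jaStep`,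
so a dependency cycle lifts backwards. -/
theorem jointlyAcyclic_iff_jaStep : JointlyAcyclic Rs ↔
    ∀ v : PNode Rs, v.IsExistential → ¬ TransGen (jaStep (fullPG Rs)) v v := by
  constructor
  · rintro h v hv hvv
    obtain ⟨-, y, -, hy⟩ := id hv
    exact h (v.rule, y) (transGen_JADep_of_jaStep hv hy hy hvv)
  · intro h u huu
    let X : Set (PNode Rs) := {v | v.IsExistential ∧
      ∃ y, v.term = Term.var y ∧ TransGen (JADep Rs) (v.rule, y) (v.rule, y)}
    have hX : ∀ u, TransGen (JADep Rs) u u →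
        ∃ v ∈ X, v.rule = u.1 ∧ v.term = Term.var u.2 := by
      rintro ⟨R, y⟩ hu
      obtain ⟨_, hs, -⟩ := TransGen.head'_iff.1 hu
      obtain ⟨v, rfl, hv, ht⟩ := PNode.exists_existential hs.1 hs.2.1
      exact ⟨v, ⟨hv, y, ht, hu⟩, rfl, ht⟩
    obtain ⟨v₀, hv₀, -⟩ := hX u huu
    obtain ⟨v, hv, hvv⟩ := exists_transGen_self (r := jaStep (fullPG Rs)) ⟨v₀, hv₀⟩ (by
      rintro w ⟨hw, z, hz, hww⟩
      obtain ⟨⟨R, y⟩, hdep, hu'⟩ := exists_pred_transGen_self hww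
      obtain ⟨v, hv, rfl, hvt⟩ := hX _ hu'
      exact ⟨v, hv, (jaStep_fullPG_iff hv.1 hvt hw hz).2 hdep⟩)
    exact h v hv.1 hvv

theorem jointlyAcyclic_iff (Rs : Finset (ERule P ar V C)) :
    JointlyAcyclic Rs ↔ SatisfiesMarking (fullPG Rs) (jaMarking Rs) := by
  rw [jointlyAcyclic_iff_jaStep, satisfiesMarking_iff_of_mark_eq isPositionGraph_fullPG
    (fun _ _ h => h) fun _ => rfl]

end JA

/-! ### Super-weak acyclicity -/

section SuperWeak

/-- The place of a position, in the skolemisation of its rule. -/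
noncomputable def PNode.place (v : PNode Rs) : Place P ar V C :=
  ⟨v.rule.skAtom v.side v.atom, v.idx⟩

theorem PNode.place_mem_places {v : PNode Rs} {x : V} (h : v.term = Term.var x) :
    v.place ∈ v.rule.places v.side x :=
  ⟨v.atom, v.atom_mem, v.idx, h, rfl⟩

theorem PNode.exists_of_mem_places {R : ERule P ar V C} (hR : R ∈ Rs) {s : Side} {x : V}
    {q : Place P ar V C} (h : q ∈ R.places s x) :
    ∃ v : PNode Rs, v.rule = R ∧ v.side = s ∧ v.term = Term.var x ∧ v.place = q := by
  obtain ⟨a, ha, i, hi, rfl⟩ := h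
  exact ⟨⟨R, hR, s, a, ha, i⟩, rfl, rfl, hi, rfl⟩

/-- Unifiable atoms have the same predicate, so equal indices already give equal predicate
positions. -/
theorem unifSubgraph_adj_iff {u b : PNode Rs} (hu : u.side = Side.head) (hb : b.side = Side.body) :
    (unifSubgraph (fullPG Rs)).Adj u b ↔ u.place.Unifiable b.place := by
  obtain ⟨R, hR, s, ⟨p, a⟩, ha, i⟩ := u
  obtain ⟨R', hR', s', ⟨p', a'⟩, ha', i'⟩ := b
  obtain rfl : s = Side.head := hu
  obtain rfl : s' = Side.body := hb
  constructor
  · rintro ⟨h | ⟨-, -, h⟩, hunif⟩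
    · cases h.2.1
    · refine ⟨hunif rfl rfl, ?_⟩
      simp only [PNode.pos, Sigma.mk.injEq] at h
      obtain ⟨rfl, h⟩ := h
      exact congrArg Fin.val (eq_of_heq h)
  · rintro ⟨hunif, hidx⟩
    refine ⟨Or.inr ⟨rfl, rfl, ?_⟩, fun _ _ => hunif⟩
    obtain ⟨σ, τ, h⟩ := hunif
    obtain rfl : p = p' := congrArg SAtom.pred h
    obtain rfl : i = i' := Fin.ext hidx
    rfl

theorem covers_places_iff {R : ERule P ar V C} (hR : R ∈ Rs) {x : V} {S : Set (PNode Rs)}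
    {T : Set (Place P ar V C)}
    (h : ∀ b : PNode Rs, b.side = Side.body → (b ∈ S ↔ ∃ p ∈ T, p.Unifiable b.place)) :
    PNode.bodyOf Rs R x ⊆ S ↔ Covers T (R.places Side.body x) := by
  constructor
  · intro hS q hq
    obtain ⟨b, hb, hs, ht, rfl⟩ := PNode.exists_of_mem_places hR hq
    exact (h b hs).1 (hS ⟨hb, hs, ht⟩)
  · rintro hT b ⟨rfl, hs, ht⟩
    exact (h b hs).2 (hT _ (hs ▸ PNode.place_mem_places ht))

theorem Covers.mono {S S' T : Set (Place P ar V C)} (h : S ⊆ S') (hc : Covers S T) :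
    Covers S' T := fun q hq => by
  obtain ⟨p, hp, hpq⟩ := hc q hq
  exact ⟨p, h hp, hpq⟩

theorem places_subset_swaMove (R : ERule P ar V C) (y : V) :
    R.places Side.head y ⊆ swaMove Rs R y :=
  Set.subset_sInter fun _ hS => hS.1

theorem swaMove_closed {R₀ R : ERule P ar V C} {y : V} (hR : R ∈ Rs) {x : V} (hx : x ∈ R.frontier)
    (h : Covers (swaMove Rs R₀ y) (R.places Side.body x)) :
    R.places Side.head x ⊆ swaMove Rs R₀ y :=
  Set.subset_sInter fun _ hS => hS.2 R hR x hx (h.mono (Set.sInter_subset_of_mem hS))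

/-- `swaMove` collects head places, whereas propagation also contains body nodes. The invariant
therefore depends on the side: membership for heads, being covered for bodies. -/
theorem swaMove_of_mem_propagate {v w : PNode Rs} (hv : v.IsExistential) {y : V}
    (hy : v.term = Term.var y) (hw : w ∈ propagate (unifSubgraph (fullPG Rs)) v.siblings) :
    (w.side = Side.head → w.place ∈ swaMove Rs v.rule y) ∧
      (w.side = Side.body → ∃ p ∈ swaMove Rs v.rule y, p.Unifiable w.place) := by
  refine propagate_subset (S := {w | (w.side = Side.head → w.place ∈ swaMove Rs v.rule y) ∧
      (w.side = Side.body → ∃ p ∈ swaMove Rs v.rule y, p.Unifiable w.place)})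
    isPositionGraph_unifSubgraph hv.siblings_side ?_ ?_ hw
  · intro u w hu hs hws huw
    refine ⟨fun h => (by rw [hws] at h; cases h),
      fun _ => ⟨u.place, ?_, (unifSubgraph_adj_iff hs hws).1 huw⟩⟩
    rcases hu with hu | hu
    · exact places_subset_swaMove _ _ (hu.1 ▸ hs ▸ PNode.place_mem_places (hu.2.2.trans hy))
    · exact hu.1 hs
  · intro u hs x hx hu h
    refine ⟨fun _ => ?_, fun h' => by rw [hs] at h'; cases h'⟩
    refine swaMove_closed u.rule_mem hx ?_ (hs ▸ PNode.place_mem_places hu)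
    intro p hp
    obtain ⟨b, hb, hbs, hbt, rfl⟩ := PNode.exists_of_mem_places u.rule_mem hp
    exact (h ⟨hb, hbs, hbt⟩).2 hbs

theorem mem_propagate_unifSubgraph_iff {v b : PNode Rs} (hv : v.IsExistential) {y : V}
    (hy : v.term = Term.var y) (hb : b.side = Side.body) :
    b ∈ propagate (unifSubgraph (fullPG Rs)) v.siblings ↔
      ∃ p ∈ swaMove Rs v.rule y, p.Unifiable b.place := by
  refine ⟨fun h => (swaMove_of_mem_propagate hv hy h).2 hb, fun ⟨p, hp, hpb⟩ => ?_⟩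
  let S : Set (Place P ar V C) := {q | ∃ u : PNode Rs, u.side = Side.head ∧ u.place = q ∧
    (u ∈ v.siblings ∨ u ∈ propagate (unifSubgraph (fullPG Rs)) v.siblings)}
  have hS : ∀ b : PNode Rs, b.side = Side.body → ∀ p ∈ S, p.Unifiable b.place →
      b ∈ propagate (unifSubgraph (fullPG Rs)) v.siblings := by
    rintro b hb p ⟨u, hs, rfl, hu⟩ hub
    have hadj := (unifSubgraph_adj_iff hs hb).2 hub
    rcases hu with hu | hu
    exacts [mem_propagate_of_adj hu hadj, mem_propagate_of_head hu hs hadj]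
  refine hS b hb p (Set.mem_sInter.1 hp S ⟨?_, ?_⟩) hpb
  · intro q hq
    obtain ⟨u, hu, hs, ht, rfl⟩ := PNode.exists_of_mem_places v.rule_mem hq
    exact ⟨u, hs, rfl, Or.inl ⟨hu, hs.trans hv.1.symm, ht.trans hy.symm⟩⟩
  · intro R hR x hx hcov q hq
    obtain ⟨u, rfl, hs, ht, rfl⟩ := PNode.exists_of_mem_places hR hq
    refine ⟨u, hs, rfl,
      Or.inr (mem_propagate_of_frontier isPositionGraph_unifSubgraph hs hx ht ?_)⟩
    rintro c ⟨hc, hcs, hct⟩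
    obtain ⟨p, hp, hpc⟩ := hcov c.place (hc ▸ hcs ▸ PNode.place_mem_places hct)
    exact hS c hcs p hp hpc

theorem reaches_unifSubgraph_iff {v w : PNode Rs} {y : V} (hv : v.IsExistential)
    (hvy : v.term = Term.var y) :
    Reaches (propagate (unifSubgraph (fullPG Rs)) v.siblings) w ↔
      ∃ x ∈ w.rule.frontier, Covers (swaMove Rs v.rule y) (w.rule.places Side.body x) :=
  exists_congr fun _ => and_congr_right fun _ => covers_places_iff w.rule_mem
    fun _ hb => mem_propagate_unifSubgraph_iff hv hvy hb

theorem triggers_of_jaStep {v w : PNode Rs} (hv : v.IsExistential)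
    (h : jaStep (unifSubgraph (fullPG Rs)) v w) : Triggers Rs v.rule w.rule := by
  obtain ⟨-, y, hy, hvy⟩ := id hv
  exact ⟨v.rule_mem, w.rule_mem, y, hy, (reaches_unifSubgraph_iff hv hvy).1 h.2⟩

theorem transGen_triggers_of_jaStep {v w : PNode Rs} (hv : v.IsExistential)
    (h : TransGen (jaStep (unifSubgraph (fullPG Rs))) v w) :
    TransGen (Triggers Rs) v.rule w.rule := by
  induction h with
  | single h => exact TransGen.single (triggers_of_jaStep hv h)
  | tail h₁ h₂ ih =>
    exact ih.tail (triggers_of_jaStep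
      (isExistential_of_reflTransGen_jaStep hv h₁.to_reflTransGen) h₂)

/-- The trigger prescribes the existential variable of `R`, but the target may be any existential
position of its rule, since being reached depends on the rule only. Trigger cycles therefore lift
when followed backwards. -/
theorem exists_jaStep_of_triggers {R : ERule P ar V C} {w : PNode Rs} (hw : w.IsExistential)
    (h : Triggers Rs R w.rule) :
    ∃ v : PNode Rs, v.IsExistential ∧ v.rule = R ∧ jaStep (unifSubgraph (fullPG Rs)) v w := by
  obtain ⟨hR, -, y, hy, hx⟩ := h
  obtain ⟨v, rfl, hv, ht⟩ := PNode.exists_existential hR hy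
  exact ⟨v, hv, rfl, hw, (reaches_unifSubgraph_iff hv ht).2 hx⟩

theorem superWeaklyAcyclic_iff_jaStep : SuperWeaklyAcyclic Rs ↔
    ∀ v : PNode Rs, v.IsExistential → ¬ TransGen (jaStep (unifSubgraph (fullPG Rs))) v v := by
  constructor
  · exact fun h v hv hvv => h v.rule (transGen_triggers_of_jaStep hv hvv)
  · intro h R hRR
    let X : Set (PNode Rs) := {v | v.IsExistential ∧ TransGen (Triggers Rs) v.rule v.rule}
    have hX : X.Nonempty := by
      obtain ⟨_, ⟨hR, -, y, hy, -⟩, -⟩ := TransGen.head'_iff.1 hRR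
      obtain ⟨v, rfl, hv, -⟩ := PNode.exists_existential hR hy
      exact ⟨v, hv, hRR⟩
    obtain ⟨v, hv, hvv⟩ := exists_transGen_self (r := jaStep (unifSubgraph (fullPG Rs))) hX (by
      rintro w ⟨hw, hww⟩
      obtain ⟨R', htr, hR'⟩ := exists_pred_transGen_self hww
      obtain ⟨v, hv, rfl, hvw⟩ := exists_jaStep_of_triggers hw htr
      exact ⟨v, ⟨hv, hR'⟩, hvw⟩)
    exact h v hv.1 hvv

theorem superWeaklyAcyclic_iff (Rs : Finset (ERule P ar V C)) :
    SuperWeaklyAcyclic Rs ↔ SatisfiesMarking (fullPG Rs) (swaMarking Rs) := by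
  rw [superWeaklyAcyclic_iff_jaStep, satisfiesMarking_iff_of_mark_eq isPositionGraph_unifSubgraph
    (fun _ _ h => h.1) fun _ => rfl]

end SuperWeak

end Nodes

theorem mainTheorem6 {P : Type*} {ar : P → ℕ} {V C : Type*} (Rs : Finset (ERule P ar V C)) :
    (WeaklyAcyclic Rs ↔ SatisfiesMarking (fullPG Rs) (waMarking Rs)) ∧
    (FiniteDomain Rs ↔ SatisfiesMarking (fullPG Rs) (fdMarking Rs)) ∧
    (ArgumentRestricted Rs ↔ SatisfiesMarking (fullPG Rs) (arMarking Rs)) ∧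
    (JointlyAcyclic Rs ↔ SatisfiesMarking (fullPG Rs) (jaMarking Rs)) ∧
    (SuperWeaklyAcyclic Rs ↔ SatisfiesMarking (fullPG Rs) (swaMarking Rs)) :=
  ⟨weaklyAcyclic_iff Rs, finiteDomain_iff Rs, argumentRestricted_iff Rs, jointlyAcyclic_iff Rs,
    superWeaklyAcyclic_iff Rs⟩
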